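/- Let $R$ be a field, $n\ge 1$, and let $c\in M_n(R)$ be a Jordan-similar matrix, i.e. some conjugate $ucu^{-1}$ with $u\in GL_n(R)$ is a block-diagonal matrix $a$ whose diagonal blocks are Jordan blocks. Let $r_1,\dots,r_t\in R$ be the distinct eigenvalues of $a$ and, for each $i$, let $\lambda_{i1}>\lambda_{i2}>\cdots>\lambda_{is_i}$ be the distinct sizes of the Jordan blocks of $a$ with eigenvalue $r_i$ (each size may occur several times). The family $\{(\lambda_{11},\dots,\lambda_{1s_1}),\dots,(\lambda_{t1},\dots,\lambda_{ts_t})\}$, indexed by the eigenvalues, is the block type of $c$. Let $S_n(c,R)=\{x\in M_n(R)\mid xc=cx\}$. Then: (1) $S_n(c,R)$ has, up to isomorphism, exactly $\sum_{i=1}^t s_i$ simple (left) modules. (2) The following are equivalent: (a) $S_n(c,R)$ is a quasi-hereditary $R$-algebra; (b) $\lambda_{ij}=s_i-j+1$ for all $1\le i\le t$, $1\le j\le s_i$; (c) $\lambda_{i1}=s_i$ for all $1\le i\le t$. Here an ideal $I$ of a finite-dimensional algebra $A$ is a heredity ideal if $I=AeA$ for some $e=e^2\in A$ with $e\,\mathrm{rad}(A)\,e=0$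 and $I$ is projective as a left $A$-module, and $A$ is quasi-hereditary if there is a chain of two-sided ideals $0=I_0\subset I_1\subset\cdots\subset I_m=A$ such that $I_k/I_{k-1}$ is a heredity ideal of $A/I_{k-1}$ for $1\le k\le m$. -/

import Mathlib

open Matrix

universe u v

/-- The upper triangular Jordan block of size `d` with eigenvalue `r`: entries `r` on the diagonal,
`1` on the superdiagonal, `0` elsewhere. -/
def jordanBlock {R : Type u} [Ring R] (r : R) (d : ℕ) : Matrix (Fin d) (Fin d) R :=
  Matrix.of fun i j => if i = j then r else if (j : ℕ) = (i : ℕ) + 1 then 1 else 0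

/-- `a` is the Jordan-block matrix `diag(J_0, …, J_{m-1})`, where `J_k` is the (nonempty) Jordan
block of size `d k` with eigenvalue `ρ k`, the blocks standing in this order on the diagonal. -/
def IsJordanDiag {R : Type u} [Ring R] {n m : ℕ} (a : Matrix (Fin n) (Fin n) R)
    (d : Fin m → ℕ) (ρ : Fin m → R) : Prop :=
  (∀ k, 0 < d k) ∧ ∃ h : ∑ k, d k = n,
    a = Matrix.reindex (finSigmaFinEquiv.trans (finCongr h)) (finSigmaFinEquiv.trans (finCongr h))
      (Matrix.blockDiagonal' fun k => jordanBlock (ρ k) (d k))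

/-- `a` is a Jordan-block matrix of block type `(lam 0, …, lam (t-1))`: it has exactly `t` distinct
eigenvalues `r 0, …, r (t-1)`, and the distinct sizes of the Jordan blocks of `a` with eigenvalue
`r i` are `lam i 0 > lam i 1 > ⋯ > lam i (s i - 1)`; each of them may occur several times. -/
def IsJordanOfBlockType {R : Type u} [Ring R] {n : ℕ} (a : Matrix (Fin n) (Fin n) R)
    {t : ℕ} {s : Fin t → ℕ} (lam : (i : Fin t) → Fin (s i) → ℕ) : Prop :=
  ∃ (m : ℕ) (d : Fin m → ℕ) (ρ : Fin m → R), IsJordanDiag a d ρ ∧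
    ∃ r : Fin t → R, Function.Injective r ∧ Set.range r = Set.range ρ ∧
      ∀ i, StrictAnti (lam i) ∧ Set.range (lam i) = d '' {k | ρ k = r i}

/-- `c` is a Jordan-similar matrix of block type `lam`: some conjugate `u c u⁻¹` is a Jordan-block
matrix of that block type. -/
def IsJordanSimilarOfBlockType {R : Type u} [CommRing R] {n : ℕ} (c : Matrix (Fin n) (Fin n) R)
    {t : ℕ} {s : Fin t → ℕ} (lam : (i : Fin t) → Fin (s i) → ℕ) : Prop :=
  ∃ g : GL (Fin n) R, IsJordanOfBlockType
    ((g : Matrix (Fin n) (Fin n) R) * c * ((g⁻¹ : GL (Fin n) R) : Matrix (Fin n) (Fin n) R)) lam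

/-- The principal centralizer matrix algebra `S_n(c, R)` of all matrices commuting with `c`. -/
abbrev principalCentralizer {R : Type u} [CommRing R] {n : ℕ} (c : Matrix (Fin n) (Fin n) R) :
    Subalgebra R (Matrix (Fin n) (Fin n) R) :=
  Subalgebra.centralizer R {c}

/-- The ring `A` has exactly `N` simple left modules up to isomorphism: there are `N` pairwise
non-isomorphic simple modules such that every simple module (in the universe `v`) is isomorphic to
one of them. -/
def HasExactlySimpleModules (A : Type u) [Ring A] (N : ℕ) : Prop :=
  ∃ S : Fin N → ModuleCat.{u} A,
    (∀ i, IsSimpleModule A (S i)) ∧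
    (∀ i j, Nonempty (S i ≃ₗ[A] S j) → i = j) ∧
    ∀ (M : Type v) [AddCommGroup M] [Module A M], IsSimpleModule A M →
      ∃ i, Nonempty (M ≃ₗ[A] S i)

/-- `I` is a heredity ideal: `I = AeA` for an idempotent `e` with `e rad(A) e = 0`, and `I` is
projective as a left `A`-module. The left ideal generated by all `x e y` is the two-sided ideal
`AeA`. -/
def IsHeredityIdeal {A : Type u} [Ring A] (I : Ideal A) : Prop :=
  (∃ e : A, e * e = e ∧ I = Ideal.span {z | ∃ x y : A, z = x * e * y} ∧
    ∀ x ∈ Ring.jacobson A, e * x * e = 0) ∧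
  Module.Projective A I

/-- The finite-dimensional `K`-algebra `A` is quasi-hereditary: there is a chain of two-sided ideals
`0 = I 0 ⊂ I 1 ⊂ ⋯ ⊂ I m = A` such that `I (k+1) / I k`, the image of `I (k+1)` in `A / I k`,
is a heredity ideal of `A / I k` for all `k < m`. -/
def IsQuasiHereditary (K : Type v) (A : Type u) [Field K] [Ring A] [Algebra K A] : Prop :=
  Module.Finite K A ∧
  ∃ (m : ℕ) (I : ℕ → TwoSidedIdeal A), I 0 = ⊥ ∧ I m = ⊤ ∧
    ∀ k < m, I k < I (k + 1) ∧
      IsHeredityIdeal ((I (k + 1)).asIdeal.map (Ideal.Quotient.mk (I k).asIdeal))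

/-! In a Jordan basis, the centralizer consists of the maps that commute with the nilpotent part `ν`
and preserve the generalized eigenspaces. On a block such a map is determined by the image of the
generator `g k`, which may be any vector of the same generalized eigenspace killed by `ν ^ d k`. The
fields `ext` and `lift` record this, and the ring theory rests on `JordanBlocks` alone;
`nonempty_jordanBlocks` connects it to matrices.

Simple modules: an element of the corner at `e k` is a scalar, its top coordinate, up to a
nilpotent, so each block yields one simple module `A ⧸ maxIdeal k`. Blocks of equal eigenvalue and
size have equivalent idempotents (`exists_e_eq`). For other pairs every composite from block `k`
through block `l` back to `k` has top coordinate zero (`π_cross`), so the simple modules differ.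
They therefore correspond to pairs of an eigenvalue and a size.

Quasi-heredity means that the sizes belonging to each eigenvalue have no gaps. Suppose `μ` has a
block larger than `p` but none of size `p + 1`, and let `ε` be the projection onto its generalized
eigenspace. As `ν * ε` is central and nilpotent, it lies in the radical, so a heredity idempotent
must kill it; inductively `ν ^ p * ε` kills every term of the chain, which thus never reaches `A`
(`pow_mul_eigenIdem_mul_eq_zero`). Conversely, without gaps the ideals `annPow p` form a heredity
chain, each layer being generated by one block idempotent of size `p + 1` per eigenvalue
(`isHeredityIdeal_map_annPow_succ`).

What remains is counting: `s` strictly decreasing positive integers have no gaps iff they are `s, …,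
1`, iff the first is `s`. -/

/-- An algebra `A` acting faithfully on a space `V` in the manner of the commutant of a matrix in
Jordan form. The block `k` of size `d k` is `e k • V`, with basis `ν ^ q • g k` for `q < d k`,
where `ν` is the nilpotent part; `ρ k` is the eigenvalue of the block, and `π k` is the coordinate
at `g k`. -/
structure JordanBlocks (K : Type*) (A : Type*) (V : Type*) [Field K] [Ring A] [Algebra K A]
    [AddCommGroup V] [Module K V] [Module A V] {m : ℕ} (d : Fin m → ℕ) (ρ : Fin m → K) where
  ν : A
  e : Fin m → A
  g : Fin m → V
  π : Fin m → V →ₗ[K] K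
  ν_comm : ∀ a, a * ν = ν * a
  e_mul_self : ∀ k, e k * e k = e k
  e_mul_ne : ∀ k l, k ≠ l → e k * e l = 0
  sum_e : ∑ k, e k = 1
  e_cross : ∀ k l, ρ k ≠ ρ l → ∀ a, e k * a * e l = 0
  e_smul_g : ∀ k, e k • g k = g k
  ext : ∀ k a, a • g k = 0 → a * e k = 0
  lift : ∀ l v, (∀ k, ρ k ≠ ρ l → e k • v = 0) → ν ^ d l • v = 0 → ∃ a, a • g l = v ∧ a * e l = a
  π_g : ∀ k, π k (g k) = 1
  π_ν : ∀ k v, π k (ν • v) = 0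
  π_e : ∀ k v, π k (e k • v) = π k v
  e_smul : ∀ k v, ∃ y, e k • v = π k v • g k + ν • y ∧ e k • y = y
  π_eq_zero : ∀ k q v, ν ^ q • v = 0 → q < d k → π k v = 0
  pow_ν_e : ∀ k, ν ^ d k * e k = 0

/-! ### Simple modules of the commutant -/

namespace JordanBlocks

variable {K : Type*} {A : Type u} {V : Type*} [Field K] [Ring A] [Algebra K A]
  [AddCommGroup V] [Module K V] [Module A V]
  {m : ℕ} {d : Fin m → ℕ} {ρ : Fin m → K} (J : JordanBlocks K A V d ρ)

lemma pow_ν_comm (q : ℕ) (a : A) : a * J.ν ^ q = J.ν ^ q * a :=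
  (Commute.pow_right (J.ν_comm a) q : _)

lemma smul_ν (a : A) (v : V) : a • J.ν • v = J.ν • a • v := by
  rw [← mul_smul, J.ν_comm, mul_smul]

lemma smul_pow_ν (q : ℕ) (a : A) (v : V) : a • J.ν ^ q • v = J.ν ^ q • a • v := by
  rw [← mul_smul, J.pow_ν_comm, mul_smul]

lemma pow_ν_g (k : Fin m) : J.ν ^ d k • J.g k = 0 := by
  rw [← J.e_smul_g, ← mul_smul, J.pow_ν_e, zero_smul]

lemma e_cross_smul_g {k l : Fin m} (h : ρ k ≠ ρ l) (a : A) : J.e k • a • J.g l = 0 := by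
  rw [← J.e_smul_g l, ← mul_smul, ← mul_smul, J.e_cross k l h, zero_smul]

/-- The maximal left ideal belonging to the block `k`. -/
def maxIdeal (k : Fin m) : Ideal A where
  carrier := {a | ∀ b : A, J.π k (b • a • J.g k) = 0}
  add_mem' {x y} hx hy b := by rw [add_smul, smul_add, map_add, hx, hy, add_zero]
  zero_mem' b := by simp
  smul_mem' c x hx b := by
    rw [smul_eq_mul, mul_smul, ← mul_smul b c]; exact hx _

lemma mem_maxIdeal {k : Fin m} {a : A} :
    a ∈ J.maxIdeal k ↔ ∀ b : A, J.π k (b • a • J.g k) = 0 := Iff.rfl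

lemma e_notMem_maxIdeal (k : Fin m) : J.e k ∉ J.maxIdeal k := fun h => by
  have := J.mem_maxIdeal.1 h 1
  rw [one_smul, J.e_smul_g, J.π_g] at this
  exact one_ne_zero this

/-- Blocks with the same eigenvalue and size have equivalent idempotents. -/
lemma exists_e_eq {k l : Fin m} (hρ : ρ k = ρ l) (hd : d k = d l) :
    ∃ a b : A, J.e k = a * J.e l * b := by
  obtain ⟨a, ha, hae⟩ := J.lift l (J.g k)
    (fun j hj => by simpa using J.e_cross_smul_g (hρ ▸ hj) 1) (by rw [← hd, J.pow_ν_g])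
  obtain ⟨b, hb, hbe⟩ := J.lift k (J.g l)
    (fun j hj => by simpa using J.e_cross_smul_g (hρ ▸ hj) 1) (by rw [hd, J.pow_ν_g])
  refine ⟨a, b, ?_⟩
  have := J.ext k (a * J.e l * b - 1) (by
    rw [sub_smul, mul_smul, mul_smul, hb, J.e_smul_g, ha, one_smul, sub_self])
  rw [sub_mul, one_mul, sub_eq_zero, mul_assoc, hbe] at this
  exact this.symm

variable [IsScalarTower K A V]

lemma smul_ground (x : K) (a : A) (v : V) : a • x • v = x • a • v := by
  rw [← algebraMap_smul A x v, ← algebraMap_smul A x (a • v), ← mul_smul, ← mul_smul,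
    Algebra.commutes]

/-- For equal eigenvalues the coordinate is the product of the top coordinates of the maps from `k`
to `l` and back. The map from the shorter block to the longer has its image killed by too small a
power of `ν`, so its top coordinate is zero. -/
lemma π_cross {k l : Fin m} (h : ¬ (ρ k = ρ l ∧ d k = d l)) (a b : A) :
    J.π k (a • J.e l • b • J.g k) = 0 := by
  by_cases hρ : ρ k = ρ l
  · obtain ⟨y, hy, -⟩ := J.e_smul l (b • J.g k)
    rw [hy, smul_add, J.smul_ν, map_add, J.π_ν, add_zero, smul_ground, map_smul, smul_eq_mul]
    rcases lt_trichotomy (d k) (d l) with hd | hd | hd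
    · rw [J.π_eq_zero l (d k) _ _ hd, zero_mul]
      rw [← J.smul_pow_ν, J.pow_ν_g, smul_zero]
    · exact absurd ⟨hρ, hd⟩ h
    · rw [J.π_eq_zero k (d l) _ _ hd, mul_zero]
      rw [← J.smul_pow_ν, J.pow_ν_g, smul_zero]
  · rw [J.e_cross_smul_g (Ne.symm hρ), smul_zero, map_zero]

/-- If `a` lies outside, some `b • a • g k` has top coordinate `x ≠ 0`. Then `e k * b * a` agrees
with the scalar `x` modulo the ideal, because on `g k` they differ by a vector in the image of `ν`;
so any larger ideal contains a unit. -/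
lemma isCoatom_maxIdeal (k : Fin m) : IsCoatom (J.maxIdeal k) := by
  refine ⟨fun h => ?_, fun I hI => ?_⟩
  · have h1 : (1 : A) ∈ J.maxIdeal k := h ▸ Submodule.mem_top
    have := J.mem_maxIdeal.1 h1 1
    rw [one_smul, one_smul, J.π_g] at this
    exact one_ne_zero this
  · obtain ⟨a, ha, ha'⟩ := SetLike.exists_of_lt hI
    rw [mem_maxIdeal, not_forall] at ha'
    obtain ⟨b, hb⟩ := ha'
    obtain ⟨z, hz, -⟩ := J.e_smul k (b • a • J.g k)
    set x := J.π k (b • a • J.g k)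
    have h1 : J.e k * b * a - algebraMap K A x ∈ I := by
      refine hI.le (J.mem_maxIdeal.2 fun c => ?_)
      rw [sub_smul, mul_smul, mul_smul, hz, algebraMap_smul, add_sub_cancel_left, J.smul_ν,
        J.π_ν]
    have h2 : algebraMap K A x ∈ I := by
      have := I.sub_mem (I.mul_mem_left (J.e k * b) ha) h1
      rwa [sub_sub_cancel] at this
    rw [Ideal.eq_top_iff_one]
    have := I.mul_mem_left (algebraMap K A x⁻¹) h2
    rwa [← map_mul, inv_mul_cancel₀ hb, map_one] at this

/-- An element of the corner ring at the block `k` with vanishing top coefficient is nilpotent. -/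
lemma exists_pow_mul_e_eq_zero {k : Fin m} {z : A} (hz : J.e k * z = z)
    (h : J.π k (z • J.g k) = 0) : z ^ d k * J.e k = 0 := by
  -- Since `z` sends `g k` into the image of `ν` and commutes with `ν`, each application of `z`
  -- gains a factor `ν`.
  have key : ∀ q : ℕ, ∃ y, z ^ q • J.g k = J.ν ^ q • y ∧ J.e k • y = y := by
    intro q
    induction q with
    | zero => exact ⟨J.g k, by simp, J.e_smul_g k⟩
    | succ q ih =>
      obtain ⟨y, hy, hy'⟩ := ih
      obtain ⟨w, hw, -⟩ := J.e_smul k y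
      obtain ⟨w', hw', -⟩ := J.e_smul k (z • J.g k)
      have hzg : z • J.g k = J.ν • w' := by
        rw [← hz, mul_smul, hw', h, zero_smul, zero_add]
      refine ⟨J.e k • (J.π k y • w' + z • w), ?_, by rw [← mul_smul, J.e_mul_self]⟩
      have : z • y = J.ν • (J.π k y • w' + z • w) := by
        conv_lhs => rw [← hy', hw, smul_add, smul_ground, hzg, J.smul_ν]
        rw [smul_add, smul_ground]
      rw [pow_succ', mul_smul, hy, J.smul_pow_ν, ← hz, mul_smul, hz, this, J.smul_ν, pow_succ,
        mul_smul]
  obtain ⟨y, hy, hy'⟩ := key (d k)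
  refine J.ext k _ ?_
  rw [hy, ← hy', ← mul_smul, J.pow_ν_e, zero_smul]

/-- A simple module not killed by `e k` is the quotient by the maximal left ideal at `k`. -/
lemma nonempty_equiv_of_e_smul_ne_zero {k : Fin m} {M : Type v} [AddCommGroup M] [Module A M]
    [IsSimpleModule A M] {s : M} (hs : J.e k • s ≠ 0) :
    Nonempty (M ≃ₗ[A] A ⧸ J.maxIdeal k) := by
  set s' := J.e k • s with hs'
  have hes : J.e k • s' = s' := by rw [hs', ← mul_smul, J.e_mul_self]
  have hsurj := IsSimpleModule.toSpanSingleton_surjective A hs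
  have hker : J.maxIdeal k = LinearMap.ker (LinearMap.toSpanSingleton A M s') := by
    refine ((J.isCoatom_maxIdeal k).le_iff_eq ?_).1 ?_ |>.symm
    · rw [Ne, LinearMap.ker_eq_top]
      intro h
      exact hs (by simpa using LinearMap.congr_fun h 1)
    · intro a ha
      rw [LinearMap.mem_ker, LinearMap.toSpanSingleton_apply]
      by_contra has
      obtain ⟨b, hb⟩ := IsSimpleModule.toSpanSingleton_surjective A has s'
      rw [LinearMap.toSpanSingleton_apply] at hb
      -- This `z` fixes `s'`, yet it is nilpotent on the corner since `a` lies in the maximal ideal.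
      set z := J.e k * b * a with hz
      have hzs : z • s' = s' := by rw [hz, mul_smul, mul_smul, hb, hes]
      have h0 : z ^ d k * J.e k = 0 := by
        refine J.exists_pow_mul_e_eq_zero (by rw [hz, ← mul_assoc, ← mul_assoc, J.e_mul_self]) ?_
        rw [hz, mul_smul]
        exact J.mem_maxIdeal.1 ha _
      have hpow : ∀ q : ℕ, z ^ q • s' = s' := by
        intro q
        induction q with
        | zero => simp
        | succ q ih => rw [pow_succ, mul_smul, hzs, ih]
      apply hs
      rw [← hpow (d k), ← hes, ← mul_smul, h0, zero_smul]
  exact ⟨((Submodule.quotEquivOfEq _ _ hker).trans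
    (LinearMap.quotKerEquivOfSurjective _ hsurj)).symm⟩

/-- By `π_cross`, `e k` annihilates the simple module at `l` when the types differ, but it does not
annihilate the one at `k`. -/
lemma eq_of_equiv {k l : Fin m} (f : (A ⧸ J.maxIdeal k) ≃ₗ[A] (A ⧸ J.maxIdeal l)) :
    ρ k = ρ l ∧ d k = d l := by
  by_contra h
  have h' : ¬ (ρ l = ρ k ∧ d l = d k) := fun h' => h ⟨h'.1.symm, h'.2.symm⟩
  have hkill : ∀ x : A ⧸ J.maxIdeal l, J.e k • x = 0 := by
    intro x
    obtain ⟨a, rfl⟩ := Submodule.Quotient.mk_surjective _ x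
    rw [← Submodule.Quotient.mk_smul, Submodule.Quotient.mk_eq_zero, mem_maxIdeal]
    intro b
    rw [smul_eq_mul, mul_smul]
    exact J.π_cross h' b a
  apply J.e_notMem_maxIdeal k
  rw [← Submodule.Quotient.mk_eq_zero, ← f.map_eq_zero_iff]
  have : (Submodule.Quotient.mk (J.e k) : A ⧸ J.maxIdeal k) =
      J.e k • Submodule.Quotient.mk (1 : A) := by
    rw [← Submodule.Quotient.mk_smul, smul_eq_mul, mul_one]
  rw [this, map_smul, hkill]

/-- The simple modules are in bijection with the types (eigenvalue and size) of blocks. -/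
theorem hasExactlySimpleModules (J : JordanBlocks K A V d ρ) {N : ℕ} (κ : Fin N → Fin m)
    (hinj : ∀ i j, ρ (κ i) = ρ (κ j) → d (κ i) = d (κ j) → i = j)
    (hsurj : ∀ k, ∃ i, ρ k = ρ (κ i) ∧ d k = d (κ i)) :
    HasExactlySimpleModules.{u, v} A N := by
  refine ⟨fun i => ModuleCat.of A (A ⧸ J.maxIdeal (κ i)), fun i => ?_, ?_, ?_⟩
  · exact isSimpleModule_iff_isCoatom.2 (J.isCoatom_maxIdeal _)
  · rintro i j ⟨f⟩
    obtain ⟨h1, h2⟩ := J.eq_of_equiv f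
    exact hinj i j h1 h2
  · intro M _ _ _
    have := IsSimpleModule.nontrivial A M
    obtain ⟨s, hs⟩ := exists_ne (0 : M)
    have : ∃ k, J.e k • s ≠ 0 := by
      by_contra! h
      apply hs
      rw [← one_smul A s, ← J.sum_e, Finset.sum_smul, Finset.sum_eq_zero fun k _ => h k]
    obtain ⟨k, hk⟩ := this
    obtain ⟨i, hρ, hd⟩ := hsurj k
    obtain ⟨a, b, hab⟩ := J.exists_e_eq hρ hd
    refine ⟨i, J.nonempty_equiv_of_e_smul_ne_zero (s := b • s) fun h => hk ?_⟩
    rw [hab, mul_smul, mul_smul, h, smul_zero]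

end JordanBlocks

/-! ### Quasi-heredity excludes gaps in the block sizes -/

lemma IsNilpotent.mem_jacobson_of_forall_commute {B : Type*} [Ring B] {z : B} (hz : IsNilpotent z)
    (hc : ∀ b, b * z = z * b) : z ∈ Ring.jacobson B := by
  rw [← Ideal.jacobson_bot, Ideal.mem_jacobson_iff]
  intro y
  obtain ⟨w, hw⟩ := ((show Commute y z from hc y).isNilpotent_mul_left hz).isUnit_one_add
  refine ⟨↑w⁻¹, ?_⟩
  rw [Ideal.mem_bot, sub_eq_zero, mul_assoc, ← w.inv_mul, hw, mul_add, mul_one, add_comm]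

/-- Membership in the radical makes `1 - e` left invertible, while `(1 - e) * e = 0`. -/
lemma eq_zero_of_mul_self_of_mem_jacobson {B : Type*} [Ring B] {e : B} (he : e * e = e)
    (h : e ∈ Ring.jacobson B) : e = 0 := by
  rw [← Ideal.jacobson_bot, Ideal.mem_jacobson_iff] at h
  obtain ⟨w, hw⟩ := h (-1)
  rw [Ideal.mem_bot] at hw
  have h1 : (w * -1 * e + w - 1) * e = 0 := by rw [hw, zero_mul]
  have h2 : (w * -1 * e + w - 1) * e = w * (e - e * e) - e := by noncomm_ring
  rw [h2, he, sub_self, mul_zero, zero_sub, neg_eq_zero] at h1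
  exact h1

namespace JordanBlocks

variable {K : Type*} {A : Type u} {V : Type*} [Field K] [Ring A] [Algebra K A]
  [AddCommGroup V] [Module K V] [Module A V]
  {m : ℕ} {d : Fin m → ℕ} {ρ : Fin m → K} (J : JordanBlocks K A V d ρ)

lemma eq_sum_mul_e (a : A) : a = ∑ k, a * J.e k := by
  rw [← Finset.mul_sum, J.sum_e, mul_one]

lemma eq_zero_of_smul_g {a : A} (h : ∀ k, a • J.g k = 0) : a = 0 := by
  rw [J.eq_sum_mul_e a, Finset.sum_eq_zero fun k _ => J.ext k a (h k)]

lemma ext_e_mul_mul_e {a b : A} (h : ∀ k l, J.e k * a * J.e l = J.e k * b * J.e l) : a = b := by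
  have key : ∀ x : A, x = ∑ k, ∑ l, J.e k * x * J.e l := fun x => by
    simp_rw [← Finset.mul_sum, ← Finset.sum_mul, J.sum_e, one_mul, mul_one]
  rw [key a, key b]
  simp_rw [h]

lemma e_mul_sum_e (S : Finset (Fin m)) (k : Fin m) :
    J.e k * ∑ l ∈ S, J.e l = if k ∈ S then J.e k else 0 := by
  have : ∀ l, J.e k * J.e l = if k = l then J.e k else 0 := fun l => by
    split_ifs with h
    · rw [← h, J.e_mul_self]
    · exact J.e_mul_ne _ _ h
  rw [Finset.mul_sum, Finset.sum_congr rfl fun l _ => this l, Finset.sum_ite_eq]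

lemma sum_e_mul_e (S : Finset (Fin m)) (k : Fin m) :
    (∑ l ∈ S, J.e l) * J.e k = if k ∈ S then J.e k else 0 := by
  have : ∀ l, J.e l * J.e k = if l = k then J.e k else 0 := fun l => by
    split_ifs with h
    · rw [h, J.e_mul_self]
    · exact J.e_mul_ne _ _ h
  rw [Finset.sum_mul, Finset.sum_congr rfl fun l _ => this l, Finset.sum_ite_eq']

lemma sum_e_mul_self (S : Finset (Fin m)) :
    (∑ l ∈ S, J.e l) * (∑ l ∈ S, J.e l) = ∑ l ∈ S, J.e l := by
  rw [Finset.sum_mul]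
  exact Finset.sum_congr rfl fun k hk => by rw [J.e_mul_sum_e, if_pos hk]

open Classical in
/-- The projection onto the generalized eigenspace of `μ`. -/
noncomputable def eigenIdem (μ : K) : A := ∑ k with ρ k = μ, J.e k

lemma e_mul_eigenIdem (μ : K) (k : Fin m) :
    J.e k * J.eigenIdem μ = open Classical in if ρ k = μ then J.e k else 0 := by
  classical
  rw [eigenIdem, e_mul_sum_e]
  exact if_congr (by simp) rfl rfl

lemma eigenIdem_mul_e (μ : K) (k : Fin m) :
    J.eigenIdem μ * J.e k = open Classical in if ρ k = μ then J.e k else 0 := by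
  classical
  rw [eigenIdem, sum_e_mul_e]
  exact if_congr (by simp) rfl rfl

lemma eigenIdem_comm (μ : K) (a : A) : a * J.eigenIdem μ = J.eigenIdem μ * a := by
  classical
  refine J.ext_e_mul_mul_e fun k l => ?_
  rw [mul_assoc, mul_assoc, J.eigenIdem_mul_e, ← mul_assoc (J.e k), ← mul_assoc (J.e k),
    J.e_mul_eigenIdem]
  by_cases h : ρ k = ρ l
  · rw [h]
    split_ifs <;> simp [mul_assoc]
  · have := J.e_cross k l h a
    split_ifs <;> simp [this]

lemma eigenIdem_mul_self (μ : K) : J.eigenIdem μ * J.eigenIdem μ = J.eigenIdem μ :=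
  J.sum_e_mul_self _

lemma isNilpotent_ν : IsNilpotent J.ν := by
  refine ⟨∑ k, d k, ?_⟩
  rw [J.eq_sum_mul_e (J.ν ^ _)]
  refine Finset.sum_eq_zero fun k _ => ?_
  rw [← Nat.sub_add_cancel (Finset.single_le_sum (fun _ _ => Nat.zero_le _) (Finset.mem_univ k)),
    pow_add, mul_assoc, J.pow_ν_e, mul_zero]

/-- If `μ` has no Jordan block of size `p + 1`, the part of `ker (ν ^ (p + 1))` in the generalized
eigenspace of `μ` lies in `ker (ν ^ p) + im ν`. -/
lemma exists_eq_add_of_pow_smul_eq_zero {μ : K} {p : ℕ} (hp : ∀ k, ρ k = μ → d k ≠ p + 1) {v : V}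
    (hv : J.ν ^ (p + 1) • J.eigenIdem μ • v = 0) :
    ∃ x y, J.eigenIdem μ • v = x + J.ν • y ∧ J.ν ^ p • x = 0 := by
  classical
  -- A block of size at most `p` goes entirely into `x`. In a block larger than `p + 1` the top
  -- coordinate vanishes, so the component is a multiple of `ν`.
  have key : ∀ k, ∃ x y, ρ k = μ → J.e k • v = x + J.ν • y ∧ J.ν ^ p • x = 0 := by
    intro k
    by_cases hk : ρ k = μ
    · have h0 : J.ν ^ (p + 1) • J.e k • v = 0 := by
        have := congrArg (J.e k • ·) hv
        simp only [smul_zero, J.smul_pow_ν] at this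
        rwa [← mul_smul (J.e k), J.e_mul_eigenIdem, if_pos hk] at this
      rcases lt_or_gt_of_ne (hp k hk) with h | h
      · refine ⟨J.e k • v, 0, fun _ => ⟨by simp, ?_⟩⟩
        rw [← mul_smul, ← Nat.sub_add_cancel (Nat.le_of_lt_succ h), pow_add, mul_assoc, J.pow_ν_e,
          mul_zero, zero_smul]
      · obtain ⟨y, hy, -⟩ := J.e_smul k v
        refine ⟨0, y, fun _ => ⟨?_, smul_zero _⟩⟩
        rw [hy, ← J.π_e, J.π_eq_zero k _ _ h0 h, zero_smul]
    · exact ⟨0, 0, fun h => absurd h hk⟩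
  choose x y hxy using key
  refine ⟨∑ k with ρ k = μ, x k, ∑ k with ρ k = μ, y k, ?_, ?_⟩
  · rw [eigenIdem, Finset.sum_smul, Finset.smul_sum, ← Finset.sum_add_distrib]
    exact Finset.sum_congr rfl fun k hk => (hxy k (by simpa using hk)).1
  · rw [Finset.smul_sum]
    exact Finset.sum_eq_zero fun k hk => (hxy k (by simpa using hk)).2

/-- If `μ` has no Jordan block of size `p + 1`, then in every chain of ideals as in the definition
of a quasi-hereditary algebra all terms are annihilated by `ν ^ p` on the generalized eigenspace of
`μ`. -/
lemma pow_mul_eigenIdem_mul_eq_zero {μ : K} {p : ℕ} (hp : ∀ k, ρ k = μ → d k ≠ p + 1)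
    {I I' : TwoSidedIdeal A} (hI : ∀ a ∈ I, J.ν ^ p * J.eigenIdem μ * a = 0)
    (hI' : IsHeredityIdeal (I'.asIdeal.map (Ideal.Quotient.mk I.asIdeal))) :
    ∀ a ∈ I', J.ν ^ p * J.eigenIdem μ * a = 0 := by
  obtain ⟨⟨e', he', hspan, hrad⟩, -⟩ := hI'
  obtain ⟨e, rfl⟩ := Ideal.Quotient.mk_surjective e'
  set ε := J.eigenIdem μ with hε
  have hcomm : ∀ a, a * (J.ν ^ p * ε) = J.ν ^ p * ε * a := fun a => by
    rw [← mul_assoc, J.pow_ν_comm, mul_assoc, J.eigenIdem_comm, ← mul_assoc]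
  have hc : ∀ a, a * (J.ν * ε) = J.ν * ε * a := fun a => by
    rw [← mul_assoc, J.ν_comm, mul_assoc, J.eigenIdem_comm, ← mul_assoc]
  have hmem : ∀ a : A, Ideal.Quotient.mk I.asIdeal a = 0 → J.ν ^ p * ε * a = 0 := fun a ha =>
    hI a (TwoSidedIdeal.mem_asIdeal.1 (Ideal.Quotient.eq_zero_iff_mem.1 ha))
  have h1 : J.ν ^ p * ε * (e * e) = J.ν ^ p * ε * e := by
    rw [← sub_eq_zero, ← mul_sub]
    exact hmem _ (by rw [map_sub, map_mul, he', sub_self])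
  -- The condition on the radical is applied to the central nilpotent element `ν * ε`.
  have h2 : J.ν ^ p * ε * (e * (J.ν * ε) * e) = 0 := by
    refine hmem _ ?_
    rw [map_mul, map_mul]
    refine hrad _ (IsNilpotent.mem_jacobson_of_forall_commute ?_ ?_)
    · refine IsNilpotent.map (f := Ideal.Quotient.mk I.asIdeal) ?_
      exact Commute.isNilpotent_mul_right (show Commute J.ν ε from (J.ν_comm ε).symm) J.isNilpotent_ν
    · intro b
      obtain ⟨b, rfl⟩ := Ideal.Quotient.mk_surjective b
      rw [← map_mul, ← map_mul, hc]
  have h3 : J.ν ^ (p + 1) * ε * e = 0 := by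
    rw [hc, mul_assoc _ e, ← mul_assoc, hc, mul_assoc _ _ (e * e), h1] at h2
    rw [← h2, mul_assoc _ ε (_ * e), ← mul_assoc ε, ← mul_assoc ε, J.pow_ν_comm, mul_assoc _ ε ε,
      J.eigenIdem_mul_self, ← mul_assoc, ← mul_assoc, ← pow_succ']
  -- By `h3` the `μ`-part of `e • v` is killed by `ν ^ (p + 1)`, so it is `x + ν • y` with `ν ^ p •
  -- x = 0`. A second application of `e`, harmless by `h1`, kills both summands.
  have h4 : J.ν ^ p * ε * e = 0 := by
    refine J.eq_zero_of_smul_g fun k => ?_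
    set v := J.g k
    obtain ⟨x, y, hxy, hx⟩ := J.exists_eq_add_of_pow_smul_eq_zero hp (v := e • v)
      (by rw [← mul_smul, ← mul_smul, ← hε, h3, zero_smul])
    have h5 : (J.ν ^ p * ε * (e * e)) • v = (J.ν ^ p * ε * e) • (ε • e • v) := by
      rw [← mul_smul, ← mul_smul]
      congr 1
      have hee : e * ε = ε * e := J.eigenIdem_comm μ e
      rw [mul_assoc _ e ε, hee, ← mul_assoc _ ε e, mul_assoc _ ε ε, J.eigenIdem_mul_self,
        mul_assoc _ e e]
    have h6 : (J.ν ^ p * ε * e) • x = 0 := by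
      rw [mul_assoc, mul_smul, ← J.smul_pow_ν, hx, smul_zero]
    have h7 : (J.ν ^ p * ε * e) • J.ν • y = 0 := by
      rw [J.smul_ν, ← mul_smul, ← mul_assoc, ← mul_assoc, ← pow_succ', h3, zero_smul]
    rw [← h1, h5, hxy, smul_add, h6, h7, add_zero]
  -- Quantifying over all representatives lets the span induction run in the quotient.
  have h6 : ∀ z ∈ I'.asIdeal.map (Ideal.Quotient.mk I.asIdeal),
      ∀ a, Ideal.Quotient.mk I.asIdeal a = z → J.ν ^ p * ε * a = 0 := by
    intro z hz
    rw [hspan] at hz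
    refine Submodule.span_induction ?_ ?_ ?_ ?_ hz
    · rintro _ ⟨x, y, rfl⟩ a ha
      obtain ⟨x, rfl⟩ := Ideal.Quotient.mk_surjective x
      obtain ⟨y, rfl⟩ := Ideal.Quotient.mk_surjective y
      have := hmem (a - x * e * y) (by rw [map_sub, ha, map_mul, map_mul, sub_self])
      rw [mul_sub, sub_eq_zero] at this
      rw [this, ← mul_assoc, ← mul_assoc, ← hcomm, mul_assoc x, h4, mul_zero, zero_mul]
    · exact fun a ha => hmem a ha
    · intro x y _ _ hx hy a ha
      obtain ⟨b, rfl⟩ := Ideal.Quotient.mk_surjective x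
      have := hy (a - b) (by rw [map_sub, ha, add_sub_cancel_left])
      rwa [mul_sub, hx b rfl, sub_zero] at this
    · intro c x _ hx a ha
      obtain ⟨b, rfl⟩ := Ideal.Quotient.mk_surjective x
      obtain ⟨c, rfl⟩ := Ideal.Quotient.mk_surjective c
      have := hmem (a - c * b) (by rw [map_sub, ha, map_mul, smul_eq_mul, sub_self])
      rw [mul_sub, sub_eq_zero] at this
      rw [this, ← mul_assoc, ← hcomm, mul_assoc, hx b rfl, mul_zero]
  exact fun a ha => h6 _ (Ideal.mem_map_of_mem _ (TwoSidedIdeal.mem_asIdeal.2 ha)) a rfl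

/-- In the quasi-hereditary case the sizes of the Jordan blocks of each eigenvalue have no gaps. -/
theorem exists_block_of_isQuasiHereditary (J : JordanBlocks K A V d ρ)
    (h : IsQuasiHereditary K A) (k₀ : Fin m) {p : ℕ}
    (hp : p < d k₀) : ∃ k, ρ k = ρ k₀ ∧ d k = p + 1 := by
  classical
  by_contra! hne
  obtain ⟨-, M, I, h0, hM, hI⟩ := h
  have key : ∀ j ≤ M, ∀ a ∈ I j, J.ν ^ p * J.eigenIdem (ρ k₀) * a = 0 := by
    intro j
    induction j with
    | zero =>
      intro _ a ha
      rw [h0, TwoSidedIdeal.mem_bot] at ha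
      rw [ha, mul_zero]
    | succ j ih =>
      intro hj
      exact J.pow_mul_eigenIdem_mul_eq_zero hne (ih (Nat.le_of_succ_le hj)) (hI j hj).2
  have h1 := key M le_rfl (J.e k₀) (by rw [hM]; trivial)
  rw [mul_assoc, J.eigenIdem_mul_e, if_pos rfl] at h1
  have := J.π_eq_zero k₀ p (J.g k₀) (by rw [← J.e_smul_g, ← mul_smul, h1, zero_smul]) hp
  rw [J.π_g] at this
  exact one_ne_zero this

end JordanBlocks

/-! ### The heredity chain when the sizes have no gaps -/

/-- A choice of one block of size `p + 1` for each eigenvalue with a block of size `> p`. -/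
lemma exists_choice_of_block {K : Type*} {m : ℕ} {d : Fin m → ℕ} {ρ : Fin m → K}
    (hfull : ∀ k p, p < d k → ∃ l, ρ l = ρ k ∧ d l = p + 1) (p : ℕ) : ∃ κ : Fin m → Fin m,
    (∀ l, p < d l → ρ (κ l) = ρ l ∧ d (κ l) = p + 1) ∧
      ∀ l l', p < d l → p < d l' → ρ l = ρ l' → κ l = κ l' := by
  classical
  -- The predicate sees `l` only through `ρ l`, so large blocks of one eigenvalue share their
  -- choice; the value for `d l ≤ p` is irrelevant.
  refine ⟨fun l => if h : p < d l then
    Classical.epsilon (h := ⟨l⟩) fun k => ρ k = ρ l ∧ d k = p + 1 else l, ?_, ?_⟩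
  · intro l h
    simp only [dif_pos h]
    exact Classical.epsilon_spec (hfull l p h)
  · intro l l' h h' hρ
    simp only [dif_pos h, dif_pos h', hρ]

namespace JordanBlocks

variable {K : Type*} {A : Type u} {V : Type*} [Field K] [Ring A] [Algebra K A]
  [AddCommGroup V] [Module K V] [Module A V]
  {m : ℕ} {d : Fin m → ℕ} {ρ : Fin m → K} (J : JordanBlocks K A V d ρ)

/-- The two-sided ideal of elements killed by `ν ^ p`. -/
def annPow (p : ℕ) : TwoSidedIdeal A :=
  TwoSidedIdeal.mk' {a | J.ν ^ p * a = 0} (mul_zero _)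
    (fun {x y} hx hy => by
      rw [Set.mem_ofPred_eq] at *
      rw [mul_add, hx, hy, add_zero])
    (fun {x} hx => by
      rw [Set.mem_ofPred_eq] at *
      rw [mul_neg, hx, neg_zero])
    (fun {x y} hy => by
      rw [Set.mem_ofPred_eq] at *
      rw [← mul_assoc, ← J.pow_ν_comm, mul_assoc, hy, mul_zero])
    (fun {x y} hx => by
      rw [Set.mem_ofPred_eq] at *
      rw [← mul_assoc, hx, zero_mul])

lemma mem_annPow {p : ℕ} {a : A} : a ∈ J.annPow p ↔ J.ν ^ p * a = 0 := by
  rw [annPow, TwoSidedIdeal.mem_mk', Set.mem_ofPred_eq]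

lemma mk_eq_zero_iff {p : ℕ} {a : A} :
    Ideal.Quotient.mk (J.annPow p).asIdeal a = 0 ↔ J.ν ^ p * a = 0 := by
  rw [Ideal.Quotient.eq_zero_iff_mem, TwoSidedIdeal.mem_asIdeal, mem_annPow]

lemma mem_map_annPow_succ {p : ℕ} {a : A} :
    Ideal.Quotient.mk (J.annPow p).asIdeal a ∈
      (J.annPow (p + 1)).asIdeal.map (Ideal.Quotient.mk (J.annPow p).asIdeal) ↔
      J.ν ^ (p + 1) * a = 0 := by
  constructor
  · intro h
    obtain ⟨b, hb, hab⟩ := (Ideal.mem_map_iff_of_surjective _ Ideal.Quotient.mk_surjective).1 h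
    rw [TwoSidedIdeal.mem_asIdeal, mem_annPow] at hb
    rw [← sub_eq_zero, ← map_sub, mk_eq_zero_iff, mul_sub, sub_eq_zero] at hab
    rw [pow_succ', mul_assoc, ← hab, ← mul_assoc, ← pow_succ', hb]
  · intro h
    exact Ideal.mem_map_of_mem _ (TwoSidedIdeal.mem_asIdeal.2 (J.mem_annPow.2 h))

lemma pow_mul_e_eq_zero {q : ℕ} {k : Fin m} (h : d k ≤ q) : J.ν ^ q * J.e k = 0 := by
  rw [← Nat.sub_add_cancel h, pow_add, mul_assoc, J.pow_ν_e, mul_zero]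

lemma pow_smul_g_ne_zero {q : ℕ} {k : Fin m} (h : q < d k) : J.ν ^ q • J.g k ≠ 0 := fun h0 => by
  have := J.π_eq_zero k q _ h0 h
  rw [J.π_g] at this
  exact one_ne_zero this

lemma annPow_lt_annPow_succ {p : ℕ} {k : Fin m} (hp : p < d k) (hk : ∀ l, d l ≤ d k) :
    J.annPow p < J.annPow (p + 1) := by
  refine lt_of_le_not_ge (fun a ha => ?_) fun h => ?_
  · rw [mem_annPow] at *
    rw [pow_succ', mul_assoc, ha, mul_zero]
  · have h1 : J.ν ^ (d k - (p + 1)) ∈ J.annPow (p + 1) := by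
      rw [mem_annPow, ← pow_add, Nat.add_sub_cancel' hp, J.eq_sum_mul_e (_ ^ _)]
      exact Finset.sum_eq_zero fun l _ => J.pow_mul_e_eq_zero (hk l)
    have h2 := h h1
    rw [mem_annPow, ← pow_add] at h2
    exact J.pow_smul_g_ne_zero (q := p + (d k - (p + 1))) (k := k) (by omega)
      (by rw [h2, zero_smul])

variable {p : ℕ} {κ : Fin m → Fin m}

/-- The block projection onto a smaller block of the same eigenvalue. -/
lemma exists_proj
    (hκ : ∀ l, p < d l → ρ (κ l) = ρ l ∧ d (κ l) = p + 1) {l : Fin m} (hl : p < d l) :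
    ∃ a, a • J.g l = J.g (κ l) ∧ a * J.e l = a := by
  exact J.lift l (J.g (κ l))
    (fun j hj => by simpa using J.e_cross_smul_g ((hκ l hl).1 ▸ hj) 1)
    (by rw [← J.e_smul_g, ← mul_smul, J.pow_mul_e_eq_zero ((hκ l hl).2.trans_le hl), zero_smul])

/-- An element killed by `ν ^ (p + 1)` factors on each block of size `> p` through the block of
size `p + 1`. -/
lemma exists_factor
    (hκ : ∀ l, p < d l → ρ (κ l) = ρ l ∧ d (κ l) = p + 1)
    {l : Fin m} (hl : p < d l) {q : A} (hq : q • J.g l = J.g (κ l))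
    (hqe : q * J.e l = q) {a : A} (ha : J.ν ^ (p + 1) * a = 0) :
    ∃ b, b * J.e (κ l) = b ∧ b * q = a * J.e l := by
  obtain ⟨b, hb, hbe⟩ := J.lift (κ l) (a • J.g l)
    (fun j hj => J.e_cross_smul_g ((hκ l hl).1 ▸ hj) a)
    (by rw [(hκ l hl).2, ← mul_smul, ha, zero_smul])
  refine ⟨b, hbe, ?_⟩
  have := J.ext l (b * q - a) (by rw [sub_smul, mul_smul, hq, hb, sub_self])
  rwa [sub_mul, sub_eq_zero, mul_assoc, hqe] at this

/-- Factoring through the blocks of size `p + 1` identifies the layer with the direct sum, over the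
blocks `l` of size `> p`, of the left ideals generated by the classes of `e (κ l)`. Smaller blocks
contribute nothing modulo `annPow p`. -/
lemma projective_map_annPow_succ
    (hκ : ∀ l, p < d l → ρ (κ l) = ρ l ∧ d (κ l) = p + 1) :
    Module.Projective (A ⧸ (J.annPow p).asIdeal)
    ((J.annPow (p + 1)).asIdeal.map (Ideal.Quotient.mk (J.annPow p).asIdeal)) := by
  classical
  set I := (J.annPow p).asIdeal
  set I' := (J.annPow (p + 1)).asIdeal.map (Ideal.Quotient.mk I)
  let L := {l : Fin m // p < d l}
  choose q hq using fun l : L => J.exists_proj hκ l.2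
  have hνe : ∀ l : L, J.ν ^ (p + 1) * J.e (κ l) = 0 := fun l =>
    J.pow_mul_e_eq_zero (hκ l l.2).2.le
  have hmem : ∀ l : L, Ideal.Quotient.mk I (J.e (κ l) * q l) ∈ I' := fun l =>
    J.mem_map_annPow_succ.2 (by rw [← mul_assoc, hνe, zero_mul])
  let s : (L → A ⧸ I) →ₗ[A ⧸ I] I' :=
    ∑ l, (LinearMap.toSpanSingleton (A ⧸ I) I' ⟨_, hmem l⟩).comp (LinearMap.proj l)
  have hs : ∀ b : L → A, (s fun l => Ideal.Quotient.mk I (b l)).1 =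
      Ideal.Quotient.mk I (∑ l, b l * (J.e (κ l) * q l)) := by
    intro b
    simp [s, map_sum]
  -- The direct sum of these left ideals, a direct summand of a free module with retraction `r`.
  let P : Submodule (A ⧸ I) (L → A ⧸ I) :=
    { carrier := {b | ∀ l, b l * Ideal.Quotient.mk I (J.e (κ l)) = b l}
      add_mem' := fun ha hb l => by rw [Pi.add_apply, add_mul, ha, hb]
      zero_mem' := fun l => by simp
      smul_mem' := fun c b hb l => by rw [Pi.smul_apply, smul_eq_mul, mul_assoc, hb] }
  let r : (L → A ⧸ I) →ₗ[A ⧸ I] P :=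
    { toFun := fun b => ⟨fun l => b l * Ideal.Quotient.mk I (J.e (κ l)), fun l => by
        rw [mul_assoc, ← map_mul, J.e_mul_self]⟩
      map_add' := fun b b' => by ext l; simp [add_mul]
      map_smul' := fun c b => by ext l; simp [mul_assoc] }
  have hP : Module.Projective (A ⧸ I) P :=
    Module.Projective.of_split P.subtype r (by
      ext b l
      exact b.2 l)
  refine Module.Projective.of_equiv' (LinearEquiv.ofBijective (s.comp P.subtype) ⟨?_, ?_⟩)
  · rw [injective_iff_map_eq_zero]
    rintro ⟨b, hb⟩ h0
    choose b' hb' using fun l => Ideal.Quotient.mk_surjective (b l)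
    obtain rfl : (fun l => Ideal.Quotient.mk I (b' l)) = b := funext hb'
    have h1 := congrArg Subtype.val h0
    rw [LinearMap.comp_apply, Submodule.subtype_apply, hs, ZeroMemClass.coe_zero,
      J.mk_eq_zero_iff] at h1
    ext l
    -- Evaluation at `g l` isolates the summand of `l`, because `q j` factors through `e j`.
    have h2 : J.ν ^ p * (b' l * J.e (κ l)) = 0 := by
      rw [← mul_assoc]
      refine J.ext (κ l) _ ?_
      have h2 := congrArg (· • J.g l) h1
      simp only [mul_smul, Finset.sum_smul, zero_smul] at h2
      rwa [Finset.sum_eq_single l, (hq l).1, J.e_smul_g, ← mul_smul] at h2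
      · intro j _ hj
        rw [← (hq j).2, ← J.e_smul_g l, mul_smul, ← mul_smul (J.e j),
          J.e_mul_ne _ _ fun h => hj (Subtype.ext h), zero_smul, smul_zero, smul_zero, smul_zero]
      · exact fun h => absurd (Finset.mem_univ l) h
    have h3 := (J.mk_eq_zero_iff (p := p)).2 h2
    rw [map_mul] at h3
    exact (hb l).symm.trans h3
  · rintro ⟨z, hz⟩
    obtain ⟨a, rfl⟩ := Ideal.Quotient.mk_surjective z
    rw [J.mem_map_annPow_succ] at hz
    choose b hb using fun l : L => J.exists_factor hκ l.2 (hq l).1 (hq l).2 hz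
    refine ⟨⟨fun l => Ideal.Quotient.mk I (b l), fun l => by rw [← map_mul, (hb l).1]⟩, ?_⟩
    ext
    rw [LinearMap.comp_apply, Submodule.subtype_apply, hs, ← sub_eq_zero, ← map_sub,
      J.mk_eq_zero_iff]
    have h1 : ∑ l : L, b l * (J.e (κ l) * q l) = ∑ l with p < d l, a * J.e l := by
      rw [Finset.sum_subtype _ (p := fun l => p < d l) (by simp)]
      exact Finset.sum_congr rfl fun l _ => by rw [← mul_assoc, (hb l).1, (hb l).2]
    rw [h1]
    have h2 := J.eq_sum_mul_e a
    rw [← Finset.sum_filter_add_sum_filter_not (s := Finset.univ) (p := fun l => p < d l)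
      (f := fun l => a * J.e l)] at h2
    rw [← neg_sub, sub_eq_of_eq_add' h2, mul_neg, neg_eq_zero, Finset.mul_sum]
    refine Finset.sum_eq_zero fun l hl => ?_
    rw [← mul_assoc, ← J.pow_ν_comm, mul_assoc, J.pow_mul_e_eq_zero (by simpa using hl), mul_zero]

/-- The idempotent is the sum of one `e k` with `d k = p + 1` for each eigenvalue having a block
larger than `p`. Its corners between different `k` vanish, and modulo `annPow p` the corner at `k`
is spanned by `e k`, so the radical meets it in zero. -/
lemma isHeredityIdeal_map_annPow_succ [IsScalarTower K A V]
    (hκ : ∀ l, p < d l → ρ (κ l) = ρ l ∧ d (κ l) = p + 1)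
    (hκ' : ∀ l l', p < d l → p < d l' → ρ l = ρ l' → κ l = κ l') : IsHeredityIdeal
    ((J.annPow (p + 1)).asIdeal.map (Ideal.Quotient.mk (J.annPow p).asIdeal)) := by
  classical
  refine ⟨?_, J.projective_map_annPow_succ hκ⟩
  set I := (J.annPow p).asIdeal
  let S : Finset (Fin m) := ({l | p < d l} : Finset (Fin m)).image κ
  have hSd : ∀ k ∈ S, d k = p + 1 := by
    intro k hk
    obtain ⟨l, hl, rfl⟩ := Finset.mem_image.1 hk
    exact (hκ l (by simpa using hl)).2
  have hSρ : ∀ k ∈ S, ∀ k' ∈ S, ρ k = ρ k' → k = k' := by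
    intro k hk k' hk' h
    obtain ⟨l, hl, rfl⟩ := Finset.mem_image.1 hk
    obtain ⟨l', hl', rfl⟩ := Finset.mem_image.1 hk'
    have hl : p < d l := by simpa using hl
    have hl' : p < d l' := by simpa using hl'
    exact hκ' l l' hl hl' (by rw [← (hκ l hl).1, h, (hκ l' hl').1])
  obtain ⟨e, he⟩ : ∃ e, e = ∑ k ∈ S, J.e k := ⟨_, rfl⟩
  have hνe : J.ν ^ (p + 1) * e = 0 := by
    rw [he, Finset.mul_sum]
    exact Finset.sum_eq_zero fun k hk => J.pow_mul_e_eq_zero (hSd k hk).le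
  refine ⟨Ideal.Quotient.mk I e, ?_, le_antisymm ?_ ?_, ?_⟩
  · rw [← map_mul, he, J.sum_e_mul_self]
  · intro z hz
    obtain ⟨a, rfl⟩ := Ideal.Quotient.mk_surjective z
    rw [J.mem_map_annPow_succ] at hz
    rw [J.eq_sum_mul_e a, map_sum]
    refine Ideal.sum_mem _ fun l _ => ?_
    by_cases hl : p < d l
    · obtain ⟨q, hq, hqe⟩ := J.exists_proj hκ hl
      obtain ⟨b, hb, hbq⟩ := J.exists_factor hκ hl hq hqe hz
      refine Ideal.subset_span ⟨Ideal.Quotient.mk I b, Ideal.Quotient.mk I q, ?_⟩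
      rw [← map_mul, ← map_mul, ← hbq]
      nth_rw 2 [← hb]
      rw [mul_assoc b, he, J.e_mul_sum_e,
        if_pos (Finset.mem_image.2 ⟨l, by simpa using hl, rfl⟩), hb]
    · have : Ideal.Quotient.mk I (a * J.e l) = 0 := by
        rw [J.mk_eq_zero_iff, ← mul_assoc, ← J.pow_ν_comm, mul_assoc,
          J.pow_mul_e_eq_zero (not_lt.1 hl), mul_zero]
      rw [this]
      exact zero_mem _
  · rw [Ideal.span_le]
    rintro _ ⟨x, y, rfl⟩
    obtain ⟨x, rfl⟩ := Ideal.Quotient.mk_surjective x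
    obtain ⟨y, rfl⟩ := Ideal.Quotient.mk_surjective y
    rw [← map_mul, ← map_mul, SetLike.mem_coe, J.mem_map_annPow_succ, ← mul_assoc, ← mul_assoc,
      ← J.pow_ν_comm, mul_assoc x, hνe, mul_zero, zero_mul]
  · intro x hx
    obtain ⟨a, rfl⟩ := Ideal.Quotient.mk_surjective x
    rw [← map_mul, ← map_mul, he, Finset.sum_mul, Finset.sum_mul, map_sum]
    refine Finset.sum_eq_zero fun k hk => ?_
    rw [Finset.mul_sum, map_sum]
    refine Finset.sum_eq_zero fun l hl => ?_
    by_cases hkl : k = l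
    · subst hkl
      set c := J.π k (a • J.g k) with hc
      -- Modulo `annPow p` only the top coordinate survives: the rest is a multiple of `ν` on a
      -- block killed by `ν ^ (p + 1)`.
      have h1 : Ideal.Quotient.mk I (J.e k * a * J.e k) =
          Ideal.Quotient.mk I (algebraMap K A c * J.e k) := by
        rw [← sub_eq_zero, ← map_sub, ← sub_mul, J.mk_eq_zero_iff, ← mul_assoc]
        refine J.ext k _ ?_
        obtain ⟨y, hy, hy'⟩ := J.e_smul k (a • J.g k)
        rw [mul_smul, sub_smul, mul_smul, hy, algebraMap_smul, ← hc, add_sub_cancel_left,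
          ← mul_smul, ← pow_succ, ← hy', ← mul_smul, J.pow_mul_e_eq_zero (hSd k hk).le, zero_smul]
      have h2 : Ideal.Quotient.mk I (J.e k * a * J.e k) ∈ Ring.jacobson (A ⧸ I) := by
        rw [map_mul, map_mul]
        exact Ideal.mul_mem_right _ _ (Ideal.mul_mem_left _ _ hx)
      by_cases hc0 : c = 0
      · rw [h1, hc0, map_zero, zero_mul, map_zero]
      · have h3 : Ideal.Quotient.mk I (J.e k) ∈ Ring.jacobson (A ⧸ I) := by
          have := Ideal.mul_mem_left _ (Ideal.Quotient.mk I (algebraMap K A c⁻¹)) h2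
          rwa [h1, ← map_mul, ← mul_assoc, ← map_mul, inv_mul_cancel₀ hc0, map_one, one_mul]
            at this
        have h4 := eq_zero_of_mul_self_of_mem_jacobson (by rw [← map_mul, J.e_mul_self]) h3
        rw [map_mul, h4, mul_zero]
    · rw [J.e_cross k l (fun h => hkl (hSρ k hk l hl h)), map_zero]

theorem isQuasiHereditary (J : JordanBlocks K A V d ρ) [IsScalarTower K A V] [Module.Finite K A]
    (hfull : ∀ k p, p < d k → ∃ l, ρ l = ρ k ∧ d l = p + 1) : IsQuasiHereditary K A := by
  -- The chain ends at the largest block size, where the power of `ν` vanishes.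
  refine ⟨inferInstance, Finset.univ.sup d, J.annPow, ?_, ?_, fun p hp => ⟨?_, ?_⟩⟩
  · ext a
    rw [mem_annPow, pow_zero, one_mul, TwoSidedIdeal.mem_bot]
  · rw [eq_top_iff]
    intro a _
    rw [mem_annPow, ← J.pow_ν_comm, J.eq_sum_mul_e (_ ^ _), Finset.sum_eq_zero, mul_zero]
    exact fun k _ => J.pow_mul_e_eq_zero (Finset.le_sup (Finset.mem_univ k))
  · obtain ⟨k, -, hk⟩ := Finset.exists_mem_eq_sup' (s := Finset.univ) (f := d) (by
      by_contra hne
      rw [Finset.not_nonempty_iff_eq_empty] at hne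
      simp [hne] at hp)
    rw [Finset.sup'_eq_sup] at hk
    exact J.annPow_lt_annPow_succ (k := k) (hk ▸ hp)
      fun l => hk ▸ Finset.le_sup (Finset.mem_univ l)
  · obtain ⟨κ, h1, h2⟩ := exists_choice_of_block hfull p
    exact J.isHeredityIdeal_map_annPow_succ h1 h2

end JordanBlocks

/-! ### The commutant of an endomorphism with a Jordan basis -/

namespace JordanBasis

variable {K V : Type*} [Field K] [AddCommGroup V] [Module K V] {m : ℕ} {d : Fin m → ℕ}
  (b : Module.Basis (Σ k, Fin (d k)) K V)

/-- The basis vectors of each block, continued by zero. -/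
noncomputable def vec (k : Fin m) (q : ℕ) : V := if h : q < d k then b ⟨k, ⟨q, h⟩⟩ else 0

/-- The linear map with prescribed values on the basis. -/
noncomputable def mk (F : Fin m → ℕ → V) : Module.End K V := b.constr K fun x => F x.1 x.2

lemma vec_eq (x : Σ k, Fin (d k)) : vec b x.1 x.2 = b x := by
  rw [vec, dif_pos x.2.2]

lemma vec_eq_zero {k : Fin m} {q : ℕ} (h : d k ≤ q) : vec b k q = 0 := dif_neg (not_lt.2 h)

lemma mk_vec {F : Fin m → ℕ → V} (k : Fin m) (q : ℕ) (hF : d k ≤ q → F k q = 0) :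
    mk b F (vec b k q) = F k q := by
  by_cases h : q < d k
  · have := vec_eq b ⟨k, ⟨q, h⟩⟩
    dsimp only at this
    rw [this, mk, Module.Basis.constr_basis]
  · rw [vec_eq_zero b (not_lt.1 h), map_zero, hF (not_lt.1 h)]

lemma hom_ext {W : Type*} [AddCommGroup W] [Module K W] {f g : V →ₗ[K] W}
    (h : ∀ k q, f (vec b k q) = g (vec b k q)) : f = g :=
  b.ext fun x => by simpa only [vec_eq] using h x.1 x.2

/-- The nilpotent part. -/
noncomputable def shift : Module.End K V := mk b fun k q => vec b k (q + 1)

/-- The left inverse of the nilpotent part on all but the last vector of each block. -/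
noncomputable def unshift : Module.End K V :=
  mk b fun k q => if q = 0 ∨ d k ≤ q then 0 else vec b k (q - 1)

/-- The projection onto a block. -/
noncomputable def proj (k : Fin m) : Module.End K V := mk b fun j q => if j = k then vec b j q else 0

/-- The coordinates, continued by zero. -/
noncomputable def coord (k : Fin m) (q : ℕ) : V →ₗ[K] K :=
  if h : q < d k then b.coord ⟨k, ⟨q, h⟩⟩ else 0

lemma coord_vec (k j : Fin m) (q r : ℕ) :
    coord b k q (vec b j r) = if j = k ∧ r = q ∧ q < d k then 1 else 0 := by
  classical
  by_cases hq : q < d k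
  · by_cases hr : r < d j
    · rw [coord, vec, dif_pos hq, dif_pos hr, Module.Basis.coord_apply, Module.Basis.repr_self,
        Finsupp.single_apply]
      refine if_congr ?_ rfl rfl
      constructor
      · intro h
        obtain ⟨rfl, h⟩ := Sigma.mk.inj h
        exact ⟨rfl, congrArg Fin.val (eq_of_heq h), hq⟩
      · rintro ⟨rfl, rfl, -⟩
        rfl
    · rw [vec_eq_zero b (not_lt.1 hr), map_zero, if_neg]
      rintro ⟨rfl, rfl, -⟩
      exact hr hq
  · rw [coord, dif_neg hq, if_neg fun h => hq h.2.2, LinearMap.zero_apply]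

@[simp] lemma shift_vec (k : Fin m) (q : ℕ) : shift b (vec b k q) = vec b k (q + 1) :=
  mk_vec b k q fun h => vec_eq_zero b (h.trans (Nat.le_succ q))

@[simp] lemma proj_vec (k j : Fin m) (q : ℕ) :
    proj b k (vec b j q) = if j = k then vec b j q else 0 :=
  mk_vec b j q fun h => by rw [vec_eq_zero b h, ite_self]

lemma unshift_vec (k : Fin m) (q : ℕ) :
    unshift b (vec b k q) = if q = 0 ∨ d k ≤ q then 0 else vec b k (q - 1) :=
  mk_vec b k q fun h => if_pos (Or.inr h)

lemma pow_shift_vec (k : Fin m) (n q : ℕ) : (shift b ^ n) (vec b k q) = vec b k (q + n) := by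
  induction n with
  | zero => rfl
  | succ n ih => rw [pow_succ', Module.End.mul_apply, ih, shift_vec, add_assoc]

lemma shift_proj (k : Fin m) : shift b * proj b k = proj b k * shift b :=
  hom_ext b fun j q => by
    simp only [Module.End.mul_apply, proj_vec, shift_vec]
    split_ifs <;> simp

lemma proj_mul_self (k : Fin m) : proj b k * proj b k = proj b k :=
  hom_ext b fun j q => by
    simp only [Module.End.mul_apply, proj_vec]
    split_ifs with h <;> simp [h]

lemma proj_mul_ne {k l : Fin m} (h : k ≠ l) : proj b k * proj b l = 0 :=
  hom_ext b fun j q => by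
    simp only [Module.End.mul_apply, proj_vec]
    split_ifs with h1
    · simp [h1, h.symm]
    · simp

lemma sum_proj : ∑ k, proj b k = 1 :=
  hom_ext b fun j q => by simp [LinearMap.sum_apply]

lemma pow_shift_proj (k : Fin m) : shift b ^ d k * proj b k = 0 :=
  hom_ext b fun j q => by
    rw [Module.End.mul_apply, proj_vec]
    split_ifs with h
    · subst h
      rw [pow_shift_vec, vec_eq_zero b (Nat.le_add_left _ _), LinearMap.zero_apply]
    · simp

lemma proj_eq_add (k : Fin m) (v : V) :
    proj b k v = coord b k 0 v • vec b k 0 + shift b (proj b k (unshift b v)) := by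
  have : proj b k = (coord b k 0).smulRight (vec b k 0) + shift b * proj b k * unshift b := by
    refine hom_ext b fun j q => ?_
    rw [LinearMap.add_apply, LinearMap.smulRight_apply, Module.End.mul_apply, Module.End.mul_apply,
      coord_vec, proj_vec, unshift_vec]
    by_cases hj : j = k
    · subst hj
      by_cases hq : d j ≤ q
      · rw [vec_eq_zero b hq, if_neg (fun h => by omega : ¬ (j = j ∧ q = 0 ∧ 0 < d j)),
          if_pos (Or.inr hq)]
        simp
      · by_cases h0 : q = 0
        · subst h0
          rw [if_pos rfl, if_pos ⟨rfl, rfl, not_le.1 hq⟩, if_pos (Or.inl rfl)]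
          simp
        · rw [if_pos rfl, if_neg (fun h => h0 h.2.1), if_neg (by tauto), proj_vec, zero_smul,
            zero_add, if_pos rfl, shift_vec, Nat.sub_add_cancel (Nat.pos_of_ne_zero h0)]
    · rw [if_neg hj, if_neg (fun h => hj h.1), zero_smul, zero_add]
      split_ifs
      · simp
      · simp [hj]
  exact LinearMap.congr_fun this v

lemma coord_zero_shift (k : Fin m) (v : V) : coord b k 0 (shift b v) = 0 := by
  have : coord b k 0 ∘ₗ shift b = 0 := hom_ext b fun j q => by
    rw [LinearMap.comp_apply, shift_vec, coord_vec, if_neg (by simp), LinearMap.zero_apply]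
  exact LinearMap.congr_fun this v

lemma coord_zero_proj (k : Fin m) (v : V) : coord b k 0 (proj b k v) = coord b k 0 v := by
  have : coord b k 0 ∘ₗ proj b k = coord b k 0 := hom_ext b fun j q => by
    rw [LinearMap.comp_apply, proj_vec]
    split_ifs with h
    · rfl
    · rw [coord_vec, if_neg fun h' => h h'.1, map_zero]
  exact LinearMap.congr_fun this v

/-- This is the source of `π_eq_zero`: the top coordinate reappears as coordinate `q` after `q`
shifts, as long as the block has not ended. -/
lemma coord_pow_shift {k : Fin m} {q : ℕ} (hq : q < d k) (v : V) :
    coord b k q ((shift b ^ q) v) = coord b k 0 v := by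
  have : coord b k q ∘ₗ (shift b ^ q) = coord b k 0 := hom_ext b fun j r => by
    rw [LinearMap.comp_apply, pow_shift_vec, coord_vec, coord_vec]
    exact if_congr ⟨fun h => ⟨h.1, by omega, by omega⟩, fun h => ⟨h.1, by omega, hq⟩⟩ rfl rfl
  exact LinearMap.congr_fun this v

section Commute

variable {ρ : Fin m → K} {T : Module.End K V}

lemma apply_eq
    (hT : ∀ k q, T (vec b k q) = ρ k • vec b k q + vec b k (q + 1))
    (v : V) : T v = shift b v + ∑ k, ρ k • proj b k v := by
  have : T = shift b + ∑ k, ρ k • proj b k := hom_ext b fun k q => by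
    rw [hT, LinearMap.add_apply, LinearMap.sum_apply, shift_vec, add_comm,
      Finset.sum_eq_single k]
    · simp
    · intro j _ hj
      simp [hj.symm]
    · simp
  rw [this]
  simp [LinearMap.sum_apply]

lemma apply_eq_of_proj_eq_zero
    (hT : ∀ k q, T (vec b k q) = ρ k • vec b k q + vec b k (q + 1))
    {l : Fin m} {v : V} (hv : ∀ k, ρ k ≠ ρ l → proj b k v = 0) :
    T v = shift b v + ρ l • v := by
  rw [apply_eq b hT, add_right_inj]
  have h1 : ∑ k, proj b k v = v := by
    simpa [LinearMap.sum_apply] using LinearMap.congr_fun (sum_proj b) v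
  conv_rhs => rw [← h1, Finset.smul_sum]
  refine Finset.sum_congr rfl fun k _ => ?_
  by_cases h : ρ k = ρ l
  · rw [h]
  · rw [hv k h, smul_zero, smul_zero]

lemma commute_proj
    (hT : ∀ k q, T (vec b k q) = ρ k • vec b k q + vec b k (q + 1))
    (k : Fin m) : Commute T (proj b k) :=
  hom_ext b fun j q => by
    simp only [Module.End.mul_apply, proj_vec, hT, map_add, map_smul]
    split_ifs <;> simp [hT]

lemma pow_sub_vec
    (hT : ∀ k q, T (vec b k q) = ρ k • vec b k q + vec b k (q + 1))
    (k : Fin m) (n q : ℕ) :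
    ((T - ρ k • (1 : Module.End K V)) ^ n) (vec b k q) = vec b k (q + n) := by
  induction n with
  | zero => rfl
  | succ n ih =>
    rw [pow_succ', Module.End.mul_apply, ih, LinearMap.sub_apply, hT, LinearMap.smul_apply,
      Module.End.one_apply, add_sub_cancel_left, add_assoc]

/-- Both `f` and the projection commute with `T`, so the vector lies in the generalized eigenspaces
of `ρ l` and of `ρ k`, which are disjoint. -/
lemma proj_comp_eq_zero
    (hT : ∀ k q, T (vec b k q) = ρ k • vec b k q + vec b k (q + 1))
    {f : Module.End K V} (hf : Commute T f) {k l : Fin m} (h : ρ k ≠ ρ l)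
    (q : ℕ) : proj b k (f (vec b l q)) = 0 := by
  have h1 : f (vec b l q) ∈ T.genEigenspace (ρ l) (d l) := by
    rw [Module.End.mem_genEigenspace_nat, LinearMap.mem_ker, ← Module.End.mul_apply]
    have : Commute ((T - ρ l • (1 : Module.End K V)) ^ d l) f :=
      (hf.sub_left ((Commute.one_left f).smul_left (ρ l))).pow_left _
    rw [this.eq, Module.End.mul_apply, pow_sub_vec b hT, vec_eq_zero b (Nat.le_add_left _ _),
      map_zero]
  have h2 : proj b k (f (vec b l q)) ∈ T.genEigenspace (ρ l) (d l) := by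
    rw [Module.End.mem_genEigenspace_nat, LinearMap.mem_ker] at h1 ⊢
    rw [← Module.End.mul_apply]
    have : Commute ((T - ρ l • (1 : Module.End K V)) ^ d l) (proj b k) :=
      ((commute_proj b hT k).sub_left ((Commute.one_left _).smul_left (ρ l))).pow_left _
    rw [this.eq, Module.End.mul_apply, h1, map_zero]
  have h3 : ((T - ρ k • (1 : Module.End K V)) ^ d k) * proj b k = 0 := hom_ext b fun j q => by
    rw [Module.End.mul_apply, proj_vec]
    split_ifs with hj
    · subst hj
      rw [pow_sub_vec b hT, vec_eq_zero b (Nat.le_add_left _ _), LinearMap.zero_apply]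
    · simp
  have h4 : proj b k (f (vec b l q)) ∈ T.genEigenspace (ρ k) (d k) := by
    rw [Module.End.mem_genEigenspace_nat, LinearMap.mem_ker, ← Module.End.mul_apply, h3,
      LinearMap.zero_apply]
  exact (Submodule.disjoint_def.1 (T.disjoint_genEigenspace h _ _)) _ h4 h2

/-- As `f` keeps each basis vector in its generalized eigenspace, `T` acts there as the shift plus a
fixed scalar, and the scalar cancels. -/
lemma commute_shift
    (hT : ∀ k q, T (vec b k q) = ρ k • vec b k q + vec b k (q + 1))
    {f : Module.End K V} (hf : Commute T f) : Commute (shift b) f :=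
  hom_ext b fun l q => by
    have h1 := apply_eq_of_proj_eq_zero b hT (l := l)
      fun k hk => proj_comp_eq_zero b hT hf hk q
    have h2 : T (f (vec b l q)) = f (T (vec b l q)) := LinearMap.congr_fun hf.eq _
    rw [hT, map_add, map_smul, add_comm, h1, add_right_cancel_iff] at h2
    rw [Module.End.mul_apply, Module.End.mul_apply, shift_vec, h2]

lemma exists_commute_of_pow_shift_eq_zero
    (hT : ∀ k q, T (vec b k q) = ρ k • vec b k q + vec b k (q + 1))
    {l : Fin m} {v : V}
    (hv : ∀ k, ρ k ≠ ρ l → proj b k v = 0) (hv' : (shift b ^ d l) v = 0) :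
    ∃ f : Module.End K V, Commute T f ∧ f (vec b l 0) = v ∧ f * proj b l = f := by
  -- The only candidate compatible with the shift; `hv'` makes it consistent past the end of the
  -- block.
  let f := mk b fun k q => if k = l then (shift b ^ q) v else 0
  have hf : ∀ k q, f (vec b k q) = if k = l then (shift b ^ q) v else 0 := fun k q =>
    mk_vec b k q fun h => by
      split_ifs with hk
      · subst hk
        rw [← Nat.sub_add_cancel h, pow_add, Module.End.mul_apply, hv', map_zero]
      · rfl
  refine ⟨f, hom_ext b fun k q => ?_, by rw [hf, if_pos rfl]; rfl, hom_ext b fun k q => ?_⟩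
  · rw [Module.End.mul_apply, Module.End.mul_apply, hT, map_add, map_smul, hf, hf]
    by_cases hk : k = l
    · subst hk
      rw [if_pos rfl, if_pos rfl, apply_eq_of_proj_eq_zero b hT (l := k), pow_succ',
        Module.End.mul_apply, add_comm]
      intro j hj
      have : Commute (shift b ^ q) (proj b j) := Commute.pow_left (shift_proj b j) q
      rw [← Module.End.mul_apply, ← this.eq, Module.End.mul_apply, hv j hj, map_zero]
    · rw [if_neg hk, if_neg hk, map_zero, smul_zero, add_zero]
  · rw [Module.End.mul_apply, proj_vec, hf]
    split_ifs with h
    · rw [hf, if_pos h]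
    · rw [map_zero]

end Commute

/-- The commutant of an endomorphism with a Jordan basis. -/
theorem nonempty_jordanBlocks {A : Type*} [Ring A] [Algebra K A] [Module A V] [IsScalarTower K A V]
    [FaithfulSMul A V] {ρ : Fin m → K} {T : Module.End K V} (hd : ∀ k, 0 < d k)
    (hT : ∀ k q, T (vec b k q) = ρ k • vec b k q + vec b k (q + 1))
    (hA : ∀ (a : A) v, T (a • v) = a • T v)
    (hA' : ∀ f : Module.End K V, Commute T f → ∃ a : A, ∀ v, a • v = f v) :
    Nonempty (JordanBlocks K A V d ρ) := by
  have hcomm : ∀ a : A, Commute T (Algebra.lsmul K K V a) := fun a => LinearMap.ext fun v => hA a v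
  obtain ⟨ν, hν⟩ := hA' (shift b) (commute_shift b hT (Commute.refl T)).symm
  choose e he using fun k => hA' (proj b k) (commute_proj b hT k)
  have ext : ∀ {x y : A}, (∀ v : V, x • v = y • v) → x = y := FaithfulSMul.eq_of_smul_eq_smul
  have hpow : ∀ (q : ℕ) (v : V), ν ^ q • v = (shift b ^ q) v := by
    intro q
    induction q with
    | zero => simp
    | succ q ih => intro v; rw [pow_succ', mul_smul, hν, ih, pow_succ', Module.End.mul_apply]
  have hshift : ∀ (a : A) v, a • shift b v = shift b (a • v) := fun a v =>
    (LinearMap.congr_fun (commute_shift b hT (hcomm a)).eq v).symm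
  refine ⟨{
    ν := ν
    e := e
    g := fun k => vec b k 0
    π := fun k => coord b k 0
    ν_comm := fun a => ext fun v => ?_
    e_mul_self := fun k => ext fun v => ?_
    e_mul_ne := fun k l h => ext fun v => ?_
    sum_e := ext fun v => ?_
    e_cross := fun k l h a => ext fun v => ?_
    e_smul_g := fun k => ?_
    ext := fun k a h => ext fun v => ?_
    lift := fun l v hv hv' => ?_
    π_g := fun k => ?_
    π_ν := fun k v => ?_
    π_e := fun k v => ?_
    e_smul := fun k v => ⟨proj b k (unshift b v), ?_, ?_⟩
    π_eq_zero := fun k q v hv hq => ?_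
    pow_ν_e := fun k => ext fun v => ?_ }⟩
  · rw [mul_smul, mul_smul, hν, hν, hshift]
  · rw [mul_smul, he, he, ← Module.End.mul_apply, proj_mul_self]
  · rw [mul_smul, he, he, ← Module.End.mul_apply, proj_mul_ne b h, zero_smul, LinearMap.zero_apply]
  · rw [Finset.sum_smul]
    simp_rw [he]
    rw [← LinearMap.sum_apply, sum_proj, one_smul, Module.End.one_apply]
  · rw [mul_smul, mul_smul, he, he, zero_smul]
    have : proj b k * Algebra.lsmul K K V a * proj b l = 0 := hom_ext b fun j q => by
      rw [Module.End.mul_apply, Module.End.mul_apply, proj_vec]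
      split_ifs with hj
      · rw [proj_comp_eq_zero b hT (hcomm a) (by rwa [hj]), LinearMap.zero_apply]
      · simp
    exact LinearMap.congr_fun this v
  · rw [he, proj_vec, if_pos rfl]
  · rw [mul_smul, he, zero_smul]
    have : Algebra.lsmul K K V a * proj b k = 0 := hom_ext b fun j q => by
      rw [Module.End.mul_apply, proj_vec]
      split_ifs with hj
      · subst hj
        have h1 := pow_shift_vec b j q 0
        rw [zero_add] at h1
        rw [← h1, ← hpow, LinearMap.zero_apply]
        change a • ν ^ q • vec b j 0 = 0
        rw [← mul_smul]
        have h2 : Commute a (ν ^ q) := Commute.pow_right (ext fun v => by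
          rw [mul_smul, mul_smul, hν, hν, hshift]) q
        rw [h2.eq, mul_smul, h, smul_zero]
      · simp
    exact LinearMap.congr_fun this v
  · simp_rw [he] at hv
    rw [hpow] at hv'
    obtain ⟨f, hf, hfv, hfp⟩ := exists_commute_of_pow_shift_eq_zero b hT hv hv'
    obtain ⟨a, ha⟩ := hA' f hf
    refine ⟨a, by rw [ha, hfv], ext fun w => ?_⟩
    rw [mul_smul, he, ha, ha, ← Module.End.mul_apply, hfp]
  · rw [coord_vec, if_pos ⟨rfl, rfl, hd k⟩]
  · rw [hν, coord_zero_shift]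
  · rw [he, coord_zero_proj]
  · rw [he, hν, ← proj_eq_add]
  · rw [he, ← Module.End.mul_apply, proj_mul_self]
  · rw [← coord_pow_shift b hq, ← hpow, hv, map_zero]
  · rw [mul_smul, he, hpow, ← Module.End.mul_apply, pow_shift_proj, zero_smul,
      LinearMap.zero_apply]

end JordanBasis

/-! ### From Jordan-similar matrices to Jordan bases -/

lemma Matrix.exists_jordanBasis {R : Type u} [Field R] {n m : ℕ} {c : Matrix (Fin n) (Fin n) R}
    {g : GL (Fin n) R} {d : Fin m → ℕ} {ρ : Fin m → R}
    (h : IsJordanDiag ((g : Matrix (Fin n) (Fin n) R) * c *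
      ((g⁻¹ : GL (Fin n) R) : Matrix (Fin n) (Fin n) R)) d ρ) :
    ∃ b : Module.Basis (Σ k, Fin (d k)) R (Fin n → R), ∀ k q,
      c.toLin' (JordanBasis.vec b k q) =
        ρ k • JordanBasis.vec b k q + JordanBasis.vec b k (q + 1) := by
  obtain ⟨-, hn, ha⟩ := h
  set σ := finSigmaFinEquiv.trans (finCongr hn)
  set a := (g : Matrix (Fin n) (Fin n) R) * c * ((g⁻¹ : GL (Fin n) R) : Matrix (Fin n) (Fin n) R)
    with ha'
  set g' := ((g⁻¹ : GL (Fin n) R) : Matrix (Fin n) (Fin n) R)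
  have hgg' : (g : Matrix (Fin n) (Fin n) R) * g' = 1 := g.mul_inv
  have hg'g : g' * (g : Matrix (Fin n) (Fin n) R) = 1 := g.inv_mul
  -- An upper triangular Jordan block lowers the index, whereas the shift raises it; hence the
  -- reversal inside each block.
  let τ : (Σ k, Fin (d k)) ≃ Fin n := (Equiv.sigmaCongrRight fun _ => Fin.revPerm).trans σ
  let b := ((Pi.basisFun R (Fin n)).map (Matrix.toLin'OfInv hgg' hg'g)).reindex τ.symm
  have hb : ∀ x, b x = g' *ᵥ Pi.single (τ x) 1 := fun x => by
    rw [Module.Basis.reindex_apply, Module.Basis.map_apply, Equiv.symm_symm, Pi.basisFun_apply]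
    rfl
  have hc : c * g' = g' * a := by
    rw [ha', ← mul_assoc, ← mul_assoc, hg'g, one_mul]
  refine ⟨b, fun k q => ?_⟩
  by_cases hq : q < d k
  swap
  · rw [JordanBasis.vec_eq_zero b (not_lt.1 hq), JordanBasis.vec_eq_zero b (by omega), map_zero,
      smul_zero, add_zero]
  have h1 : a *ᵥ Pi.single (τ ⟨k, q, hq⟩) 1 = ρ k • Pi.single (τ ⟨k, q, hq⟩) 1 +
      if h : q + 1 < d k then Pi.single (τ ⟨k, q + 1, h⟩) 1 else 0 := by
    ext i
    obtain ⟨⟨l, i⟩, rfl⟩ := σ.surjective i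
    have hτ : ∀ q' (hq' : q' < d k), τ ⟨k, q', hq'⟩ = σ ⟨k, Fin.rev ⟨q', hq'⟩⟩ := fun _ _ => rfl
    rw [mulVec_single_one, hτ, col_apply, ha, reindex_apply, submatrix_apply,
      Equiv.symm_apply_apply, Equiv.symm_apply_apply]
    by_cases hl : l = k
    · subst hl
      have hi := i.2
      rw [blockDiagonal'_apply_eq, jordanBlock, of_apply, Pi.add_apply, Pi.smul_apply,
        Pi.single_apply]
      simp only [EmbeddingLike.apply_eq_iff_eq, Sigma.mk.injEq, heq_eq_eq, true_and, smul_eq_mul,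
        mul_ite, mul_one, mul_zero]
      by_cases h2 : i = Fin.rev ⟨q, hq⟩
      · rw [if_pos h2, if_pos h2]
        split_ifs with h3
        · rw [Pi.single_apply, if_neg, add_zero]
          rw [hτ, σ.injective.eq_iff, h2]
          simp only [Sigma.mk.injEq, heq_eq_eq, true_and, Fin.ext_iff, Fin.val_rev]
          omega
        · rw [Pi.zero_apply, add_zero]
      · rw [if_neg h2, if_neg h2, zero_add]
        split_ifs with h3 h4 h4
        · rw [hτ, Pi.single_apply, if_pos]
          rw [σ.injective.eq_iff]
          simp only [Sigma.mk.injEq, heq_eq_eq, true_and, Fin.ext_iff, Fin.val_rev] at *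
          omega
        · simp only [Fin.ext_iff, Fin.val_rev] at *
          omega
        · rw [hτ, Pi.single_apply, if_neg]
          rw [σ.injective.eq_iff]
          simp only [Sigma.mk.injEq, heq_eq_eq, true_and, Fin.ext_iff, Fin.val_rev] at *
          omega
        · rfl
    · rw [blockDiagonal'_apply_ne _ _ _ hl, Pi.add_apply, Pi.smul_apply, Pi.single_apply, if_neg,
        smul_zero, zero_add]
      · split_ifs with h3
        · rw [hτ, Pi.single_apply, if_neg]
          rw [σ.injective.eq_iff]
          exact fun h => hl (congrArg Sigma.fst h)
        · rfl
      · rw [σ.injective.eq_iff]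
        exact fun h => hl (congrArg Sigma.fst h)
  rw [JordanBasis.vec, dif_pos hq, hb, Matrix.toLin'_apply, mulVec_mulVec, hc, ← mulVec_mulVec, h1,
    mulVec_add, mulVec_smul, JordanBasis.vec]
  split_ifs with h2
  · rw [hb]
  · rw [mulVec_zero]

lemma nonempty_jordanBlocks_principalCentralizer {R : Type u} [Field R] {n m : ℕ}
    {c : Matrix (Fin n) (Fin n) R} {g : GL (Fin n) R} {d : Fin m → ℕ} {ρ : Fin m → R}
    (h : IsJordanDiag ((g : Matrix (Fin n) (Fin n) R) * c *
      ((g⁻¹ : GL (Fin n) R) : Matrix (Fin n) (Fin n) R)) d ρ) :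
    Nonempty (JordanBlocks R (principalCentralizer c) (Fin n → R) d ρ) := by
  obtain ⟨b, hb⟩ := exists_jordanBasis h
  have smul_def : ∀ (x : principalCentralizer c) (v : Fin n → R),
    x • v = (x : Matrix (Fin n) (Fin n) R) *ᵥ v := fun x v => rfl
  have : IsScalarTower R (principalCentralizer c) (Fin n → R) := ⟨fun r x v => by
    rw [smul_def, smul_def, Subalgebra.coe_smul, smul_mulVec]⟩
  have : FaithfulSMul (principalCentralizer c) (Fin n → R) := ⟨fun {x y} hxy => by
    refine Subtype.ext (Matrix.toLin'.injective (LinearMap.ext fun v => ?_))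
    simpa only [smul_def, toLin'_apply] using hxy v⟩
  refine JordanBasis.nonempty_jordanBlocks b h.1 hb (fun x v => ?_) fun f hf => ?_
  · rw [smul_def, smul_def, toLin'_apply, toLin'_apply, mulVec_mulVec, mulVec_mulVec,
      (Subalgebra.mem_centralizer_iff R).1 x.2 c rfl]
  · refine ⟨⟨LinearMap.toMatrix' f, (Subalgebra.mem_centralizer_iff R).2 ?_⟩, fun v => ?_⟩
    · rintro _ rfl
      apply Matrix.toLin'.injective
      rw [toLin'_mul, toLin'_mul, toLin'_toMatrix']
      exact hf.eq
    · rw [smul_def, LinearMap.toMatrix'_mulVec]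

/-! ### Strictly decreasing sequences and the final translation -/

/-- A strictly decreasing family of `s` positive integers starts with `s` iff it is `s, …, 2, 1`. -/
lemma StrictAnti.eq_sub_iff {s : ℕ} (hs : 0 < s) {f : Fin s → ℕ} (hf : StrictAnti f)
    (hpos : ∀ j, 0 < f j) : (∀ j : Fin s, f j = s - j) ↔ f ⟨0, hs⟩ = s := by
  refine ⟨fun h => h _, fun h => ?_⟩
  -- Strict decrease pinches `f`: descending from `f 0 = s` bounds it above, climbing from the
  -- positive last term bounds it below.
  have h1 : ∀ j (hj : j < s), f ⟨j, hj⟩ + j ≤ s := by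
    intro j
    induction j with
    | zero => intro _; exact h.le
    | succ j ih =>
      intro hj
      have := ih (by omega)
      have := hf (show (⟨j, by omega⟩ : Fin s) < ⟨j + 1, hj⟩ from Nat.lt_succ_self j)
      omega
  have h2 : ∀ i (hi : i < s), i + 1 ≤ f ⟨s - 1 - i, by omega⟩ := by
    intro i
    induction i with
    | zero => intro _; exact hpos _
    | succ i ih =>
      intro hi
      have := ih (by omega)
      have := hf (show (⟨s - 1 - (i + 1), by omega⟩ : Fin s) < ⟨s - 1 - i, by omega⟩ from
        Fin.mk_lt_mk.2 (by omega))
      omega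
  intro j
  have h3 := h1 j j.2
  have h4 := h2 (s - 1 - j) (by omega)
  have h5 : (⟨s - 1 - (s - 1 - j), by omega⟩ : Fin s) = j := Fin.ext (by
    have := j.2
    simp only
    omega)
  rw [h5] at h4
  simp only [Fin.eta] at h3
  omega

/-- A strictly decreasing family of `s` positive integers is `s, …, 2, 1` iff its range has no
gaps. -/
lemma StrictAnti.eq_sub_iff_range {s : ℕ} {f : Fin s → ℕ} (hf : StrictAnti f)
    (hpos : ∀ j, 0 < f j) :
    (∀ j : Fin s, f j = s - j) ↔ ∀ j p, p < f j → ∃ j', f j' = p + 1 := by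
  constructor
  · intro h j p hp
    rw [h] at hp
    refine ⟨⟨s - 1 - p, by omega⟩, ?_⟩
    rw [h]
    simp only
    omega
  · intro h
    rcases Nat.eq_zero_or_pos s with rfl | hs
    · exact fun j => j.elim0
    rw [hf.eq_sub_iff hs hpos]
    -- Without gaps the values fill the interval up to the first one, so comparing cardinalities
    -- gives `f 0 = s`.
    have h1 : Finset.univ.image f = Finset.Icc 1 (f ⟨0, hs⟩) := by
      ext p
      simp only [Finset.mem_image, Finset.mem_univ, true_and, Finset.mem_Icc]
      constructor
      · rintro ⟨j, rfl⟩
        exact ⟨hpos j, hf.antitone (Fin.mk_le_mk.2 (Nat.zero_le _))⟩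
      · rintro ⟨hp1, hp2⟩
        obtain ⟨j, hj⟩ := h ⟨0, hs⟩ (p - 1) (by omega)
        exact ⟨j, by omega⟩
    have h2 := congrArg Finset.card h1
    rw [Finset.card_image_of_injective _ hf.injective, Finset.card_univ, Fintype.card_fin,
      Nat.card_Icc] at h2
    omega

theorem corollary4p8 {R : Type u} [Field R] {n : ℕ} (c : Matrix (Fin n) (Fin n) R)
    {t : ℕ} {s : Fin t → ℕ} (lam : (i : Fin t) → Fin (s i) → ℕ)
    (hc : IsJordanSimilarOfBlockType c lam) :
    HasExactlySimpleModules.{u, v} (principalCentralizer c) (∑ i, s i) ∧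
    (IsQuasiHereditary R (principalCentralizer c) ↔
      ∀ (i : Fin t) (j : Fin (s i)), (lam i j : ℤ) = (s i : ℤ) - ((j : ℤ) + 1) + 1) ∧
    ((∀ (i : Fin t) (j : Fin (s i)), (lam i j : ℤ) = (s i : ℤ) - ((j : ℤ) + 1) + 1) ↔
      ∀ i : Fin t, ∃ h : 0 < s i, lam i ⟨0, h⟩ = s i) := by
  obtain ⟨g, m, d, ρ, hJ, r, hr, hrρ, hlam⟩ := hc
  obtain ⟨J⟩ := nonempty_jordanBlocks_principalCentralizer hJ
  have : IsScalarTower R (principalCentralizer c) (Fin n → R) := ⟨fun x y v => by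
    change ((x • y : principalCentralizer c) : Matrix (Fin n) (Fin n) R) *ᵥ v =
      x • ((y : Matrix (Fin n) (Fin n) R) *ᵥ v)
    rw [Subalgebra.coe_smul, smul_mulVec]⟩
  have hblock : ∀ i j, ∃ k, ρ k = r i ∧ d k = lam i j := fun i j => by
    have h1 : lam i j ∈ d '' {k | ρ k = r i} := (hlam i).2 ▸ Set.mem_range_self j
    exact h1
  have hblock' : ∀ k, ∃ i j, ρ k = r i ∧ d k = lam i j := fun k => by
    obtain ⟨i, hi⟩ : ρ k ∈ Set.range r := hrρ ▸ Set.mem_range_self k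
    obtain ⟨j, hj⟩ : d k ∈ Set.range (lam i) := (hlam i).2 ▸ ⟨k, hi.symm, rfl⟩
    exact ⟨i, j, hi.symm, hj.symm⟩
  have hpos : ∀ i j, 0 < lam i j := fun i j => by
    obtain ⟨k, -, hk⟩ := hblock i j
    exact hk ▸ hJ.1 k
  have hs : ∀ i, 0 < s i := fun i => by
    obtain ⟨k, hk⟩ : r i ∈ Set.range ρ := hrρ ▸ Set.mem_range_self i
    obtain ⟨i', j, h1, -⟩ := hblock' k
    have := hr (hk.symm.trans h1)
    subst this
    exact Fin.pos_iff_nonempty.2 ⟨j⟩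
  -- Here `j` counts from zero, whence the `j + 1`; as `j < s i`, truncated subtraction agrees with
  -- that in `ℤ`.
  have hsub : (∀ (i : Fin t) (j : Fin (s i)), (lam i j : ℤ) = (s i : ℤ) - ((j : ℤ) + 1) + 1) ↔
      ∀ i, ∀ j : Fin (s i), lam i j = s i - j :=
    forall_congr' fun i => forall_congr' fun j => by
      have := j.2
      omega
  refine ⟨?_, ?_, ?_⟩
  · choose κ hκ using hblock
    let e : Fin (∑ i, s i) ≃ Σ i, Fin (s i) := finSigmaFinEquiv.symm
    refine J.hasExactlySimpleModules (fun x => κ (e x).1 (e x).2) (fun x y h1 h2 => ?_) fun k => ?_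
    · rw [(hκ _ _).1, (hκ _ _).1] at h1
      rw [(hκ _ _).2, (hκ _ _).2] at h2
      apply e.injective
      generalize e x = x' at *
      generalize e y = y' at *
      obtain ⟨i, j⟩ := x'
      obtain ⟨i', j'⟩ := y'
      obtain rfl := hr h1
      have h3 : j = j' := (hlam i).1.injective h2
      rw [h3]
    · obtain ⟨i, j, h1, h2⟩ := hblock' k
      refine ⟨e.symm ⟨i, j⟩, ?_⟩
      rw [Equiv.apply_symm_apply, (hκ i j).1, (hκ i j).2]
      exact ⟨h1, h2⟩
  · rw [hsub, forall_congr' fun i => (hlam i).1.eq_sub_iff_range (hpos i)]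
    constructor
    · intro h i j p hp
      obtain ⟨k, hk1, hk2⟩ := hblock i j
      obtain ⟨k', hk1', hk2'⟩ := J.exists_block_of_isQuasiHereditary h k (hk2 ▸ hp)
      obtain ⟨i', j', h1, h2⟩ := hblock' k'
      obtain rfl : i' = i := hr (by rw [← h1, hk1', hk1])
      exact ⟨j', by rw [← h2, hk2']⟩
    · intro h
      refine J.isQuasiHereditary fun k p hp => ?_
      obtain ⟨i, j, h1, h2⟩ := hblock' k
      obtain ⟨j', hj'⟩ := h i j p (h2 ▸ hp)
      obtain ⟨k', hk1, hk2⟩ := hblock i j'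
      exact ⟨k', by rw [hk1, h1], by rw [hk2, hj']⟩
  · rw [hsub]
    refine forall_congr' fun i => ?_
    rw [(hlam i).1.eq_sub_iff (hs i) (hpos i)]
    exact ⟨fun h => ⟨hs i, h⟩, fun ⟨_, h⟩ => h⟩
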